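/- Throughout, $X,Y,A,B$ are second countable compact Hausdorff spaces, $H$ is a separable complex Hilbert space, $\mathcal B(H)$ is the algebra of bounded operators on $H$, and $\mathfrak A_S$ denotes the Borel $\sigma$-algebra of a space $S$. A *quantum probability measure* on $A$ with values in $\mathcal B(H)$ is a map $E:\mathfrak A_A\to\mathcal B(H)^+$ into the positive operators such that $E(A)=I_H$ and $E\left(\bigcup_{i=1}^\infty\alpha_i\right)=\sum_{i=1}^\infty E(\alpha_i)$ in the weak* topology of $\mathcal B(H)$ for all pairwise disjoint $\alpha_1,\alpha_2,\ldots\in\mathfrak A_A$. An *operator-valued information channel* $E:X\to(A;H)$ is a family $(E(\cdot|x))_{x\in X}$ of quantum probability measures on $A$ with values in $\mathcal B(H)$ such that, for all $\alpha\in\mathfrak A_A$ and $\xi,\eta\in H$, the function $x\mapsto\langle E(\alpha|x)\xi,\eta\rangle$ is Borel. It is *projection-valued* if $E(\alpha|x)$ is an orthogonal projection for all $\alpha\in\mathfrak A_A$ and $x\in X$. Two channels $E:X\to(A;H)$ and $F:Y\to(B;H)$ have *commuting ranges* if $E(\delta|x)F(\theta|y)=F(\theta|y)E(\delta|x)$ for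 all $x\in X$, $y\in Y$, $\delta\in\mathfrak A_A$, $\theta\in\mathfrak A_B$. **Theorem.** Let $E:X\to(A;H)$ and $F:Y\to(B;H)$ be operator-valued information channels with commuting ranges. Then there exists a unique operator-valued information channel $E\cdot F:X\times Y\to(A\times B;H)$ such that $$(E\cdot F)(\delta\times\theta\,|\,x,y)=E(\delta|x)\,F(\theta|y),\qquad \delta\in\mathfrak A_A,\ \theta\in\mathfrak A_B,\ x\in X,\ y\in Y.$$ Moreover, if $E$ and $F$ are projection-valued, then so is $E\cdot F$. -/

import Mathlib

open MeasureTheory TopologicalSpace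

noncomputable section

namespace QInfo

/-- The normal functional `T ↦ ∑ₙ ⟨T ξₙ, ηₙ⟩` on `B(H)` given by two square-summable sequences of
vectors. These are exactly the functionals `T ↦ Tr (T S)` with `S = ∑ₙ ξₙ ⊗ ηₙ*` trace class.
(Mathlib's inner product is linear in its last argument.) -/
def normalFunctional {H : Type*} [NormedAddCommGroup H] [InnerProductSpace ℂ H]
    (ξ η : lp (fun _ : ℕ => H) 2) (T : H →L[ℂ] H) : ℂ :=
  ∑' n, inner ℂ (η n) (T (ξ n))

/-- The series defining a normal functional converges absolutely. -/
theorem summable_normalFunctional {H : Type*} [NormedAddCommGroup H] [InnerProductSpace ℂ H]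
    (ξ η : lp (fun _ : ℕ => H) 2) (T : H →L[ℂ] H) :
    Summable fun n => ‖(inner ℂ (η n) (T (ξ n)) : ℂ)‖ := by
  have h : Summable fun n => ‖η n‖ * ‖ξ n‖ :=
    lp.summable_mul (by rw [Real.holderConjugate_iff]; norm_num) η ξ
  refine Summable.of_nonneg_of_le (fun _ => norm_nonneg _) (fun n => ?_) (h.mul_left ‖T‖)
  calc ‖(inner ℂ (η n) (T (ξ n)) : ℂ)‖ ≤ ‖η n‖ * ‖T (ξ n)‖ := norm_inner_le_norm _ _
    _ ≤ ‖η n‖ * (‖T‖ * ‖ξ n‖) := by gcongr; exact T.le_opNorm _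
    _ = ‖T‖ * (‖η n‖ * ‖ξ n‖) := by ring

/-- The weak* (ultraweak, σ-weak) topology of `B(H)`, the dual of the trace class operators: the
coarsest topology that makes all normal functionals continuous. -/
abbrev weakStarTopology (H : Type*) [NormedAddCommGroup H] [InnerProductSpace ℂ H] :
    TopologicalSpace (H →L[ℂ] H) :=
  ⨅ (ξ : lp (fun _ : ℕ => H) 2) (η : lp (fun _ : ℕ => H) 2),
    TopologicalSpace.induced (normalFunctional ξ η) inferInstance

/-- `T = ∑ᵢ Tᵢ` in the weak* topology of `B(H)`. -/
def HasSumWeakStar {H : Type*} [NormedAddCommGroup H] [InnerProductSpace ℂ H]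
    (f : ℕ → H →L[ℂ] H) (T : H →L[ℂ] H) : Prop :=
  @HasSum (H →L[ℂ] H) ℕ _ (weakStarTopology H) f T (SummationFilter.unconditional ℕ)

/-- A quantum probability measure on `A` with values in `B(H)`. As for Mathlib's vector measures,
it is defined on the measurable sets and takes the value `0` on all other sets, so that two
quantum probability measures are equal iff they agree on the measurable sets. -/
@[ext]
structure QPM (A : Type*) [MeasurableSpace A]
    (H : Type*) [NormedAddCommGroup H] [InnerProductSpace ℂ H] where
  /-- The value on a set. -/
  toFun : Set A → H →L[ℂ] H
  not_measurable' : ∀ α : Set A, ¬ MeasurableSet α → toFun α = 0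
  isPositive' : ∀ α : Set A, MeasurableSet α → (toFun α).IsPositive
  univ' : toFun Set.univ = 1
  iUnion' : ∀ α : ℕ → Set A, (∀ i, MeasurableSet (α i)) →
    Pairwise (fun i j => Disjoint (α i) (α j)) →
    HasSumWeakStar (fun i => toFun (α i)) (toFun (⋃ i, α i))

/-- A spectral measure: a quantum probability measure whose values are orthogonal projections. -/
def QPM.IsSpectral {A : Type*} [MeasurableSpace A]
    {H : Type*} [NormedAddCommGroup H] [InnerProductSpace ℂ H] [CompleteSpace H]
    (E : QPM A H) : Prop :=
  ∀ α : Set A, MeasurableSet α → IsStarProjection (E.toFun α)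

/-- Weak measurability of an operator-valued function. -/
def WeaklyMeasurable {X : Type*} [MeasurableSpace X]
    {H : Type*} [NormedAddCommGroup H] [InnerProductSpace ℂ H] (F : X → H →L[ℂ] H) : Prop :=
  ∀ ξ η : H, Measurable fun x => (inner ℂ η (F x ξ) : ℂ)

/-- An operator-valued information channel `E : X → (A; H)`. -/
@[ext]
structure Channel (X : Type*) [MeasurableSpace X] (A : Type*) [MeasurableSpace A]
    (H : Type*) [NormedAddCommGroup H] [InnerProductSpace ℂ H] where
  /-- The quantum probability measure `E(· | x)`. -/
  qpm : X → QPM A H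
  weaklyMeasurable' : ∀ α : Set A, MeasurableSet α → WeaklyMeasurable fun x => (qpm x).toFun α

/-- The operator `E(α | x)`. -/
def Channel.val {X : Type*} [MeasurableSpace X] {A : Type*} [MeasurableSpace A]
    {H : Type*} [NormedAddCommGroup H] [InnerProductSpace ℂ H]
    (E : Channel X A H) (α : Set A) (x : X) : H →L[ℂ] H :=
  (E.qpm x).toFun α

/-- A projection-valued information channel. -/
def Channel.IsProjectionValued {X : Type*} [MeasurableSpace X] {A : Type*} [MeasurableSpace A]
    {H : Type*} [NormedAddCommGroup H] [InnerProductSpace ℂ H] [CompleteSpace H]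
    (E : Channel X A H) : Prop :=
  ∀ x : X, (E.qpm x).IsSpectral

/-- `E` and `F` have commuting ranges: `E(δ | x)` and `F(θ | y)` always commute. -/
def CommutingRanges {X : Type*} [MeasurableSpace X] {A : Type*} [MeasurableSpace A]
    {Y : Type*} [MeasurableSpace Y] {B : Type*} [MeasurableSpace B]
    {H : Type*} [NormedAddCommGroup H] [InnerProductSpace ℂ H]
    (E : Channel X A H) (F : Channel Y B H) : Prop :=
  ∀ (x : X) (y : Y) (δ : Set A) (θ : Set B), MeasurableSet δ → MeasurableSet θ →
    Commute (E.val δ x) (F.val θ y)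

/-- `G` is a product channel of `E` and `F`: `G(δ × θ | x, y) = E(δ | x) F(θ | y)`. -/
def IsProductChannel {X : Type*} [MeasurableSpace X] {A : Type*} [MeasurableSpace A]
    {Y : Type*} [MeasurableSpace Y] {B : Type*} [MeasurableSpace B]
    {H : Type*} [NormedAddCommGroup H] [InnerProductSpace ℂ H]
    (E : Channel X A H) (F : Channel Y B H) (G : Channel (X × Y) (A × B) H) : Prop :=
  ∀ (δ : Set A) (θ : Set B), MeasurableSet δ → MeasurableSet θ → ∀ (x : X) (y : Y),
    G.val (δ ×ˢ θ) (x, y) = E.val δ x * F.val θ y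

end QInfo

end

/-! For fixed $x,y$ and $\xi\in H$, the function $(\delta,\theta)\mapsto\langle
E(\delta|x)F(\theta|y)\xi,\xi\rangle$ is nonnegative, because a product of commuting positive
operators is positive, and it is a finite measure in each variable separately. Such a bimeasure need
not extend to a measure on general measurable spaces, but it does when one factor is standard Borel,
by disintegration (`IsBimeasure.exists_measure_prod`). This gives a measure $\rho_\xi$ on $A\times
B$ for every $\xi$.

On rectangles $\xi\mapsto\rho_\xi(s)$ is the quadratic form of a bounded operator. The sets with
this property are closed under complements and countable disjoint unions, so by the π-λ theorem they
are all the measurable sets (`exists_represents`). The representing operators form the product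
measure (`exists_qpm_of_represents`, `QPM.exists_prod`).

Uniqueness, weak measurability in $(x,y)$ and projection-valuedness are also π-λ arguments starting
from rectangles. On a rectangle, measurability follows from Parseval's identity in a countable
orthonormal basis, and the projection property holds because commuting projections have a projection
as product. -/

namespace QInfo

open Filter ProbabilityTheory Set
open scoped ENNReal Topology

/-! ### Extension of positive bimeasures to measures -/

section Bimeasure

variable {A : Type*} [MeasurableSpace A] {B : Type*} [MeasurableSpace B]

/-- A finite positive bimeasure, given by its two families of partial measures. -/
structure IsBimeasure (m : Set B → Measure A) (n : Set A → Measure B) : Prop where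
  finite_left : ∀ s, IsFiniteMeasure (m s)
  finite_right : ∀ t, IsFiniteMeasure (n t)
  apply_eq : ∀ s t, MeasurableSet s → MeasurableSet t → m s t = n t s

namespace IsBimeasure

variable {m : Set B → Measure A} {n : Set A → Measure B}

theorem le_of_subset (h : IsBimeasure m n) {s s' : Set B} (hs : MeasurableSet s)
    (hs' : MeasurableSet s') (hss : s ⊆ s') : m s ≤ m s' := by
  refine Measure.le_iff.2 fun t ht => ?_
  rw [h.apply_eq s t hs ht, h.apply_eq s' t hs' ht]
  exact measure_mono hss

theorem setLIntegral_rnDeriv (h : IsBimeasure m n) {s : Set B} (hs : MeasurableSet s) (t : Set A) :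
    ∫⁻ a in t, (m s).rnDeriv (m univ) a ∂(m univ) = m s t := by
  have := h.finite_left
  exact Measure.setLIntegral_rnDeriv
    (Measure.absolutelyContinuous_of_le (h.le_of_subset hs .univ (subset_univ s))) t

theorem rnDeriv_mono (h : IsBimeasure m n) {s s' : Set B} (hs : MeasurableSet s)
    (hs' : MeasurableSet s') (hss : s ⊆ s') :
    (m s).rnDeriv (m univ) ≤ᵐ[m univ] (m s').rnDeriv (m univ) := by
  have := h.finite_left
  refine ae_le_of_forall_setLIntegral_le_of_sigmaFinite (Measure.measurable_rnDeriv _ _)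
    fun t _ _ => ?_
  rw [h.setLIntegral_rnDeriv hs, h.setLIntegral_rnDeriv hs']
  exact h.le_of_subset hs hs' hss t

theorem rnDeriv_le_one (h : IsBimeasure m n) {s : Set B} (hs : MeasurableSet s) :
    (m s).rnDeriv (m univ) ≤ᵐ[m univ] fun _ => 1 := by
  have := h.finite_left
  filter_upwards [h.rnDeriv_mono hs .univ (subset_univ s), Measure.rnDeriv_self (m univ)]
    with a h1 h2
  exact h1.trans h2.le

/-- The derivatives decrease almost everywhere, and their infimum has the right integral over each
`t` because `n t` is continuous from above. This is where countable additivity in the second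
variable enters. -/
theorem tendsto_rnDeriv_of_antitone (h : IsBimeasure m n) {s : ℕ → Set B}
    (hs : ∀ k, MeasurableSet (s k)) (hanti : Antitone s) :
    ∀ᵐ a ∂(m univ), Tendsto (fun k => (m (s k)).rnDeriv (m univ) a) atTop
      (𝓝 ((m (⋂ k, s k)).rnDeriv (m univ) a)) := by
  have := h.finite_left
  have := h.finite_right
  have hmono : ∀ k, (m (s (k + 1))).rnDeriv (m univ) ≤ᵐ[m univ] (m (s k)).rnDeriv (m univ) :=
    fun k => h.rnDeriv_mono (hs _) (hs _) (hanti k.le_succ)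
  have heq : (fun a => ⨅ k, (m (s k)).rnDeriv (m univ) a) =ᵐ[m univ]
      (m (⋂ k, s k)).rnDeriv (m univ) := by
    refine ae_eq_of_forall_setLIntegral_eq_of_sigmaFinite
      (.iInf fun k => Measure.measurable_rnDeriv _ _) (Measure.measurable_rnDeriv _ _)
      fun t ht _ => ?_
    rw [h.setLIntegral_rnDeriv (.iInter hs), lintegral_iInf_ae
      (fun k => Measure.measurable_rnDeriv _ _) (fun k => ae_restrict_of_ae (hmono k))]
    · simp_rw [h.setLIntegral_rnDeriv (hs _), h.apply_eq _ t (hs _) ht,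
        h.apply_eq _ t (.iInter hs) ht]
      exact (hanti.measure_iInter (fun k => (hs k).nullMeasurableSet)
        ⟨0, measure_ne_top _ _⟩).symm
    · rw [h.setLIntegral_rnDeriv (hs 0)]
      exact measure_ne_top _ _
  filter_upwards [heq, ae_all_iff.2 hmono] with a ha hm
  rw [← ha]
  exact tendsto_atTop_iInf (antitone_nat_of_succ_le hm)

theorem tendsto_rnDeriv_of_monotone (h : IsBimeasure m n) {s : ℕ → Set B}
    (hs : ∀ k, MeasurableSet (s k)) (hmon : Monotone s) :
    ∀ᵐ a ∂(m univ), Tendsto (fun k => (m (s k)).rnDeriv (m univ) a) atTop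
      (𝓝 ((m (⋃ k, s k)).rnDeriv (m univ) a)) := by
  have := h.finite_left
  have hmono : ∀ k, (m (s k)).rnDeriv (m univ) ≤ᵐ[m univ] (m (s (k + 1))).rnDeriv (m univ) :=
    fun k => h.rnDeriv_mono (hs _) (hs _) (hmon k.le_succ)
  have hmono' : ∀ᵐ a ∂(m univ), Monotone fun k => (m (s k)).rnDeriv (m univ) a := by
    filter_upwards [ae_all_iff.2 hmono] with a ha using monotone_nat_of_le_succ ha
  have heq : (fun a => ⨆ k, (m (s k)).rnDeriv (m univ) a) =ᵐ[m univ]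
      (m (⋃ k, s k)).rnDeriv (m univ) := by
    refine ae_eq_of_forall_setLIntegral_eq_of_sigmaFinite
      (.iSup fun k => Measure.measurable_rnDeriv _ _) (Measure.measurable_rnDeriv _ _)
      fun t ht _ => ?_
    rw [h.setLIntegral_rnDeriv (.iUnion hs), lintegral_iSup'
      (fun k => (Measure.measurable_rnDeriv _ _).aemeasurable) (ae_restrict_of_ae hmono')]
    simp_rw [h.setLIntegral_rnDeriv (hs _), h.apply_eq _ t (hs _) ht,
      h.apply_eq _ t (.iUnion hs) ht]
    exact hmon.measure_iUnion.symm
  filter_upwards [heq, hmono'] with a ha hm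
  rw [← ha]
  exact tendsto_atTop_iSup hm

end IsBimeasure

theorem tendsto_add_one_div (t : ℚ) :
    Tendsto (fun k : ℕ => t + 1 / ((k : ℚ) + 1)) atTop (𝓝 t) := by
  simpa using tendsto_const_nhds.add (tendsto_one_div_add_atTop_nhds_zero_nat (𝕜 := ℚ))

theorem iInter_Iic_add_one_div (t : ℚ) :
    ⋂ k : ℕ, Iic (((t + 1 / ((k : ℚ) + 1) : ℚ) : ℝ)) = Iic (t : ℝ) := by
  ext x
  simp only [mem_iInter, mem_Iic]
  constructor
  · intro hx
    refine ge_of_tendsto' (x := atTop) (f := fun k : ℕ => ((t + 1 / ((k : ℚ) + 1) : ℚ) : ℝ))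
      ?_ hx
    exact (Rat.continuous_coe_real.tendsto t).comp (tendsto_add_one_div t)
  · intro hx k
    refine hx.trans ?_
    exact_mod_cast le_add_of_nonneg_right (by positivity)

/-- The Radon-Nikodym derivatives of a bimeasure on half-lines form almost everywhere a
distribution function. -/
theorem IsBimeasure.ae_isRatStieltjesPoint {m : Set ℝ → Measure A} {n : Set A → Measure ℝ}
    (h : IsBimeasure m n) :
    ∀ᵐ a ∂(m univ), IsRatStieltjesPoint
      (fun a (q : ℚ) => ((m (Iic (q : ℝ))).rnDeriv (m univ) a).toReal) a := by
  have := h.finite_left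
  have := h.finite_right
  have hmono : ∀ᵐ a ∂(m univ), ∀ q r : ℚ, q ≤ r →
      (m (Iic (q : ℝ))).rnDeriv (m univ) a ≤ (m (Iic (r : ℝ))).rnDeriv (m univ) a := by
    refine ae_all_iff.2 fun q => ae_all_iff.2 fun r => ?_
    by_cases hqr : q ≤ r
    · filter_upwards [h.rnDeriv_mono measurableSet_Iic measurableSet_Iic
        (Iic_subset_Iic.2 (show (q : ℝ) ≤ r by exact_mod_cast hqr))] with a ha _ using ha
    · simp [hqr]
  have hone : ∀ᵐ a ∂(m univ), ∀ q : ℚ, (m (Iic (q : ℝ))).rnDeriv (m univ) a ≤ 1 :=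
    ae_all_iff.2 fun q => h.rnDeriv_le_one measurableSet_Iic
  have hright : ∀ᵐ a ∂(m univ), ∀ t : ℚ, Tendsto
      (fun k : ℕ => (m (Iic ((t + 1 / ((k : ℚ) + 1) : ℚ) : ℝ))).rnDeriv (m univ) a) atTop
      (𝓝 ((m (Iic (t : ℝ))).rnDeriv (m univ) a)) := by
    refine ae_all_iff.2 fun t => ?_
    have := h.tendsto_rnDeriv_of_antitone
      (s := fun k : ℕ => Iic ((t + 1 / ((k : ℚ) + 1) : ℚ) : ℝ)) (fun _ => measurableSet_Iic)
      (fun k l hkl => Iic_subset_Iic.2 (by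
        have : (t + 1 / ((l : ℚ) + 1) : ℚ) ≤ t + 1 / ((k : ℚ) + 1) := by gcongr
        exact_mod_cast this))
    rwa [iInter_Iic_add_one_div] at this
  have hbot := h.tendsto_rnDeriv_of_antitone
    (s := fun k : ℕ => Iic ((-(k : ℚ) : ℚ) : ℝ)) (fun _ => measurableSet_Iic)
    (fun k l hkl => Iic_subset_Iic.2 (by
      have : (-(l : ℚ) : ℚ) ≤ -(k : ℚ) := by gcongr
      exact_mod_cast this))
  have hbot0 : ⋂ k : ℕ, Iic ((-(k : ℚ) : ℚ) : ℝ) = ∅ := by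
    refine eq_empty_of_forall_notMem fun x hx => ?_
    obtain ⟨k, hk⟩ := exists_nat_gt (-x)
    have := mem_iInter.1 hx k
    simp only [mem_Iic] at this
    push_cast at this
    linarith
  have hm0 : m ∅ = 0 := by
    refine Measure.ext fun t ht => ?_
    rw [h.apply_eq _ _ .empty ht]
    simp
  -- The limits at `-∞` and `+∞` are the derivatives of `m ∅ = 0` and of `m univ`, that is, 0 and 1.
  rw [hbot0, hm0] at hbot
  have htop := h.tendsto_rnDeriv_of_monotone
    (s := fun k : ℕ => Iic ((k : ℚ) : ℝ)) (fun _ => measurableSet_Iic)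
    (fun k l hkl => Iic_subset_Iic.2 (by exact_mod_cast hkl))
  have htop1 : ⋃ k : ℕ, Iic ((k : ℚ) : ℝ) = univ := by
    refine eq_univ_of_forall fun x => ?_
    obtain ⟨k, hk⟩ := exists_nat_gt x
    exact mem_iUnion.2 ⟨k, by simpa using hk.le⟩
  rw [htop1] at htop
  filter_upwards [hmono, hone, hright, hbot, htop, Measure.rnDeriv_self (m univ),
    Measure.rnDeriv_zero (m univ)] with a hmono hone hright hbot htop hself hzero
  rw [hself] at htop
  rw [hzero] at hbot
  have hfin : ∀ q : ℚ, (m (Iic (q : ℝ))).rnDeriv (m univ) a ≠ ∞ :=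
    fun q => ((hone q).trans_lt ENNReal.one_lt_top).ne
  have hm : Monotone fun q : ℚ => ((m (Iic (q : ℝ))).rnDeriv (m univ) a).toReal :=
    fun q r hqr => ENNReal.toReal_mono (hfin r) (hmono q r hqr)
  refine ⟨hm, ?_, ?_, fun t => ?_⟩
  · refine (tendsto_iff_tendsto_subseq_of_monotone hm
      (tendsto_natCast_atTop_atTop (R := ℚ))).2 ?_
    exact (ENNReal.tendsto_toReal ENNReal.one_ne_top).comp htop
  · have hm' : Antitone fun q : ℚ => ((m (Iic ((-q : ℚ) : ℝ))).rnDeriv (m univ) a).toReal :=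
      fun q r hqr => hm (neg_le_neg hqr)
    have h1 : Tendsto (fun q : ℚ => ((m (Iic ((-q : ℚ) : ℝ))).rnDeriv (m univ) a).toReal) atTop
        (𝓝 0) := by
      refine (tendsto_iff_tendsto_subseq_of_antitone hm'
        (tendsto_natCast_atTop_atTop (R := ℚ))).2 ?_
      exact (ENNReal.tendsto_toReal ENNReal.zero_ne_top).comp hbot
    simpa [Function.comp_def] using h1.comp tendsto_neg_atBot_atTop
  · have hbdd : BddBelow (range fun r : Ioi t =>
        ((m (Iic ((r : ℚ) : ℝ))).rnDeriv (m univ) a).toReal) :=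
      ⟨0, by rintro _ ⟨r, rfl⟩; exact ENNReal.toReal_nonneg⟩
    refine le_antisymm ?_ (le_ciInf fun r => hm (le_of_lt r.2))
    -- Right continuity along the rationals `t + 1/(k+1)` suffices, since each of these values
    -- bounds the infimum from above.
    refine ge_of_tendsto' ((ENNReal.tendsto_toReal (hfin t)).comp (hright t)) fun k => ?_
    exact ciInf_le hbdd ⟨t + 1 / ((k : ℚ) + 1), by simp; positivity⟩

/-- Disintegration over `m univ`: the derivatives on rational half-lines are the conditional
distribution functions of a Markov kernel, and the extension is the composition product of `m univ`
with it. -/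
theorem IsBimeasure.exists_measure_prod_real {m : Set ℝ → Measure A} {n : Set A → Measure ℝ}
    (h : IsBimeasure m n) :
    ∃ ρ : Measure (A × ℝ), ∀ s t, MeasurableSet s → MeasurableSet t → ρ (t ×ˢ s) = m s t := by
  have := h.finite_left
  have := h.finite_right
  let f : A → ℚ → ℝ := fun a q => ((m (Iic (q : ℝ))).rnDeriv (m univ) a).toReal
  have hf : Measurable f :=
    -- `toRatCDF` puts a default distribution function at the exceptional points, which form a null
    -- set, so that the kernel is Markov everywhere.
    measurable_pi_iff.2 fun q => (Measure.measurable_rnDeriv _ _).ennreal_toReal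
  have hF := isMeasurableRatCDF_toRatCDF hf
  let κ : Kernel A ℝ :=
    { toFun := fun a => (hF.stieltjesFunction a).measure
      measurable' := hF.measurable_measure_stieltjesFunction }
  have hκ : IsMarkovKernel κ := ⟨fun a => hF.instIsProbabilityMeasure_stieltjesFunction a⟩
  refine ⟨(m univ).compProd κ, fun s t hs ht => ?_⟩
  rw [Measure.compProd_apply_prod ht hs, h.apply_eq s t hs ht]
  -- With `t` fixed, both sides are finite measures in `s`, so it is enough to compare them on
  -- rational half-lines and on the whole line.
  have hbind : ∀ s, MeasurableSet s →
      ((m univ).restrict t).bind κ s = ∫⁻ a in t, κ a s ∂(m univ) :=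
    fun s hs => Measure.bind_apply hs κ.measurable.aemeasurable
  rw [← hbind s hs]
  have hfb : IsFiniteMeasure (((m univ).restrict t).bind κ) := ⟨by
    rw [hbind _ .univ]; simp⟩
  congr 1
  refine ext_of_generate_finite _ Real.borel_eq_generateFrom_Iic_rat Real.isPiSystem_Iic_rat ?_ ?_
  · intro s hs
    simp only [mem_iUnion, mem_singleton_iff] at hs
    obtain ⟨q, rfl⟩ := hs
    rw [hbind _ measurableSet_Iic, ← h.apply_eq _ t measurableSet_Iic ht,
      ← h.setLIntegral_rnDeriv measurableSet_Iic]
    refine lintegral_congr_ae (ae_restrict_of_ae ?_)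
    filter_upwards [h.ae_isRatStieltjesPoint, h.rnDeriv_le_one (measurableSet_Iic (a := (q : ℝ)))]
      with a ha ha'
    change (hF.stieltjesFunction a).measure _ = _
    rw [hF.measure_stieltjesFunction_Iic, hF.stieltjesFunction_eq,
      toRatCDF_of_isRatStieltjesPoint ha]
    exact ENNReal.ofReal_toReal (ha'.trans_lt ENNReal.one_lt_top).ne
  · rw [hbind _ .univ, ← h.apply_eq _ t .univ ht]
    simp

/-- A finite positive bimeasure with a standard Borel factor extends to a measure. -/
theorem IsBimeasure.exists_measure_prod [StandardBorelSpace B] {m : Set B → Measure A}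
    {n : Set A → Measure B} (h : IsBimeasure m n) :
    ∃ ρ : Measure (A × B), ∀ s t, MeasurableSet s → MeasurableSet t → ρ (t ×ˢ s) = m s t := by
  have := h.finite_left
  have := h.finite_right
  have he := measurableEmbedding_embeddingReal B
  have h' : IsBimeasure (fun s => m (embeddingReal B ⁻¹' s))
      (fun t => (n t).map (embeddingReal B)) :=
    ⟨fun s => inferInstance, fun t => inferInstance, fun s t hs ht => by
      rw [Measure.map_apply he.measurable hs, h.apply_eq _ _ (he.measurable hs) ht]⟩
  obtain ⟨ρ, hρ⟩ := h'.exists_measure_prod_real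
  have hE : MeasurableEmbedding (Prod.map id (embeddingReal B) : A × B → A × ℝ) :=
    MeasurableEmbedding.id.prodMap he
  -- The bimeasure was pushed forward to `ℝ`; pulling its extension back recovers the original
  -- values on rectangles because the embedding preserves measurability of images.
  refine ⟨ρ.comap (Prod.map id (embeddingReal B)), fun s t hs ht => ?_⟩
  rw [hE.comap_apply, Set.prodMap_image_prod, image_id, hρ _ _ (he.measurableSet_image.2 hs) ht,
    preimage_image_eq _ he.injective]

end Bimeasure

/-! ### Quadratic forms, weak* convergence and positive contractions -/

section Operators

variable {H : Type*} [NormedAddCommGroup H] [InnerProductSpace ℂ H]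

theorem ext_of_inner_self {S T : H →L[ℂ] H}
    (h : ∀ ξ : H, inner ℂ ξ (S ξ) = (inner ℂ ξ (T ξ) : ℂ)) : S = T := by
  refine ContinuousLinearMap.coe_injective ((ext_inner_map _ _).1 fun ξ => ?_)
  have := congrArg (starRingEnd ℂ) (h ξ)
  simpa only [inner_conj_symm] using! this

theorem isPositive_of_inner_self {T : H →L[ℂ] H} {r : H → ℝ} (hr : ∀ ξ, 0 ≤ r ξ)
    (h : ∀ ξ : H, (inner ℂ ξ (T ξ) : ℂ) = r ξ) : T.IsPositive := by
  refine (ContinuousLinearMap.isPositive_iff_complex T).2 fun ξ => ?_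
  have h' : (inner ℂ (T ξ) ξ : ℂ) = r ξ := by
    rw [← inner_conj_symm, h, Complex.conj_ofReal]
  rw [h']
  simpa using hr ξ

theorem inner_self_eq_re {T : H →L[ℂ] H} (hT : T.IsPositive) (ξ : H) :
    (inner ℂ ξ (T ξ) : ℂ) = ((inner ℂ ξ (T ξ) : ℂ).re : ℂ) := by
  exact Complex.ext rfl (by simpa using (Complex.nonneg_iff.1 (hT.inner_nonneg_right ξ)).2.symm)

theorem tendsto_inner_of_tendsto_inner_self {ι : Type*} {l : Filter ι} {T : ι → H →L[ℂ] H}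
    {S : H →L[ℂ] H}
    (h : ∀ ξ : H, Tendsto (fun i => (inner ℂ ξ (T i ξ) : ℂ)) l (𝓝 (inner ℂ ξ (S ξ)))) (η ξ : H) :
    Tendsto (fun i => (inner ℂ η (T i ξ) : ℂ)) l (𝓝 (inner ℂ η (S ξ))) := by
  -- Polarization.
  have key : ∀ R : H →L[ℂ] H, (inner ℂ η (R ξ) : ℂ) =
      (inner ℂ (ξ + η) (R (ξ + η)) - inner ℂ (ξ - η) (R (ξ - η))
        + Complex.I * inner ℂ (ξ + Complex.I • η) (R (ξ + Complex.I • η))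
        - Complex.I * inner ℂ (ξ - Complex.I • η) (R (ξ - Complex.I • η))) / 4 := by
    intro R
    simp only [map_add, map_sub, map_smul, inner_add_left, inner_add_right, inner_sub_left,
      inner_sub_right, inner_smul_left, inner_smul_right, Complex.conj_I]
    ring_nf
    simp only [Complex.I_sq]
    ring
  simp_rw [key]
  exact ((((h _).sub (h _)).add ((h _).const_mul _)).sub ((h _).const_mul _)).div_const _

/-- Bounded convergence in the weak operator topology implies weak* convergence. -/
theorem tendsto_normalFunctional {ι : Type*} {l : Filter ι} {T : ι → H →L[ℂ] H}
    {S : H →L[ℂ] H} {C : ℝ} (hC : ∀ i, ‖T i‖ ≤ C)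
    (h : ∀ η ξ : H, Tendsto (fun i => (inner ℂ η (T i ξ) : ℂ)) l (𝓝 (inner ℂ η (S ξ))))
    (ξ η : lp (fun _ : ℕ => H) 2) :
    Tendsto (fun i => normalFunctional ξ η (T i)) l (𝓝 (normalFunctional ξ η S)) := by
  have hs : Summable fun n => C * (‖η n‖ * ‖ξ n‖) :=
    (lp.summable_mul (by rw [Real.holderConjugate_iff]; norm_num) η ξ).mul_left C
  refine tendsto_tsum_of_dominated_convergence hs (fun n => h _ _) (.of_forall fun i n => ?_)
  calc ‖(inner ℂ (η n) (T i (ξ n)) : ℂ)‖ ≤ ‖η n‖ * ‖T i (ξ n)‖ := norm_inner_le_norm _ _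
    _ ≤ ‖η n‖ * (C * ‖ξ n‖) := by gcongr; exact (T i).le_of_opNorm_le (hC i) _
    _ = C * (‖η n‖ * ‖ξ n‖) := by ring

theorem hasSumWeakStar_iff {f : ℕ → H →L[ℂ] H} {T : H →L[ℂ] H} :
    HasSumWeakStar f T ↔ ∀ ξ η : lp (fun _ : ℕ => H) 2,
      Tendsto (fun s : Finset ℕ => normalFunctional ξ η (∑ i ∈ s, f i)) atTop
        (𝓝 (normalFunctional ξ η T)) := by
  unfold HasSumWeakStar HasSum
  rw [SummationFilter.unconditional_filter]
  simp only [nhds_iInf, tendsto_iInf, nhds_induced, tendsto_comap_iff]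
  rfl

theorem HasSumWeakStar.hasSum_inner {f : ℕ → H →L[ℂ] H} {T : H →L[ℂ] H}
    (h : HasSumWeakStar f T) (η ξ : H) :
    HasSum (fun i => (inner ℂ η (f i ξ) : ℂ)) (inner ℂ η (T ξ)) := by
  have key : ∀ R : H →L[ℂ] H, normalFunctional (lp.single 2 0 ξ) (lp.single 2 0 η) R =
      inner ℂ η (R ξ) := by
    intro R
    unfold normalFunctional
    rw [tsum_eq_single 0]
    · simp
    · intro n hn
      simp [hn]
  have := hasSumWeakStar_iff.1 h (lp.single 2 0 ξ) (lp.single 2 0 η)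
  simp only [key, sum_apply, inner_sum] at this
  exact this

theorem le_one_of_inner_self_le {T : H →L[ℂ] H} (hT : T.IsPositive)
    (h : ∀ ξ : H, (inner ℂ ξ (T ξ) : ℂ).re ≤ ‖ξ‖ ^ 2) : T ≤ 1 := by
  rw [ContinuousLinearMap.le_def]
  refine isPositive_of_inner_self (r := fun ξ => ‖ξ‖ ^ 2 - (inner ℂ ξ (T ξ) : ℂ).re)
    (fun ξ => sub_nonneg.2 (h ξ)) fun ξ => ?_
  rw [sub_apply, inner_sub_right, inner_self_eq_re hT]
  simp [inner_self_eq_norm_sq_to_K]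

variable [CompleteSpace H]

theorem norm_le_one_of_isPositive {T : H →L[ℂ] H} (hT : T.IsPositive)
    (h : ∀ ξ : H, (inner ℂ ξ (T ξ) : ℂ).re ≤ ‖ξ‖ ^ 2) : ‖T‖ ≤ 1 :=
  (CStarAlgebra.norm_le_one_iff_of_nonneg T
    ((ContinuousLinearMap.nonneg_iff_isPositive T).2 hT)).2 (le_one_of_inner_self_le hT h)

/-- This is `T ^ 2 ≤ T`. It turns control of quadratic forms into control of norms, hence weak
convergence into strong convergence. -/
theorem norm_sq_apply_le {T : H →L[ℂ] H} (hT : T.IsPositive) (h1 : T ≤ 1) (ξ : H) :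
    ‖T ξ‖ ^ 2 ≤ (inner ℂ ξ (T ξ) : ℂ).re := by
  have h0 := (ContinuousLinearMap.nonneg_iff_isPositive T).2 hT
  have h2 : T ^ 2 ≤ T := by simpa using CStarAlgebra.pow_antitone h0 h1 one_le_two
  have h3 := ((ContinuousLinearMap.le_def _ _).1 h2).re_inner_nonneg_right ξ
  have h4 : (inner ℂ ξ ((T ^ 2) ξ) : ℂ) = (‖T ξ‖ : ℂ) ^ 2 := by
    rw [pow_two]
    exact (hT.inner_left_eq_inner_right ξ (T ξ)).symm.trans (inner_self_eq_norm_sq_to_K _)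
  rw [sub_apply, inner_sub_right, h4, map_sub, sub_nonneg, RCLike.re_to_complex,
    RCLike.re_to_complex] at h3
  exact_mod_cast h3

/-- From `P ≤ T ≤ 1`, the form of `1 - T` vanishes on the range of `P`; since `1 - T` is a positive
contraction, it kills that range. -/
theorem mul_eq_right_of_isStarProjection {P T : H →L[ℂ] H} (hP : IsStarProjection P)
    (hT : T.IsPositive) (hPT : ∀ ξ : H, (inner ℂ ξ (P ξ) : ℂ).re ≤ (inner ℂ ξ (T ξ) : ℂ).re)
    (h1 : ∀ ξ : H, (inner ℂ ξ (T ξ) : ℂ).re ≤ ‖ξ‖ ^ 2) : T * P = P := by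
  have hT1 := le_one_of_inner_self_le hT h1
  have hS : (1 - T).IsPositive := (ContinuousLinearMap.le_def _ _).1 hT1
  have hS1 : 1 - T ≤ 1 := by
    simpa using (ContinuousLinearMap.nonneg_iff_isPositive T).2 hT
  ext ξ
  have hPP : P (P ξ) = P ξ := congrArg (fun R : H →L[ℂ] H => R ξ) hP.isIdempotentElem
  have h2 := norm_sq_apply_le hS hS1 (P ξ)
  have h3 := hPT (P ξ)
  have h4 : (1 - T) (P ξ) = P ξ - T (P ξ) := rfl
  have h5 : (inner ℂ (P ξ) (P ξ) : ℂ).re = ‖P ξ‖ ^ 2 := by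
    rw [inner_self_eq_norm_sq_to_K]; norm_cast
  rw [hPP, h5] at h3
  rw [h4, inner_sub_right, Complex.sub_re, h5] at h2
  have h6 : ‖P ξ - T (P ξ)‖ = 0 := by
    have := norm_nonneg (P ξ - T (P ξ))
    nlinarith
  exact (sub_eq_zero.1 (norm_eq_zero.1 h6)).symm

end Operators

/-! ### From families of scalar measures to operators -/

section Representation

variable {H : Type*} [NormedAddCommGroup H] [InnerProductSpace ℂ H]
  {S : Type*} [MeasurableSpace S]

/-- The operator `T` has the quadratic form `ξ ↦ ρ ξ s`. -/
def Represents (ρ : H → Measure S) (s : Set S) (T : H →L[ℂ] H) : Prop :=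
  ∀ ξ : H, (inner ℂ ξ (T ξ) : ℂ) = ((ρ ξ).real s : ℂ)

theorem Represents.isPositive {ρ : H → Measure S} {s : Set S} {T : H →L[ℂ] H}
    (h : Represents ρ s T) : T.IsPositive :=
  isPositive_of_inner_self (fun _ => measureReal_nonneg) h

theorem hasSum_measureReal_iUnion (μ : Measure S) [IsFiniteMeasure μ] {f : ℕ → Set S}
    (hf : ∀ i, MeasurableSet (f i)) (hd : Pairwise fun i j => Disjoint (f i) (f j)) :
    HasSum (fun i => μ.real (f i)) (μ.real (⋃ i, f i)) := by
  have h := measure_iUnion hd hf (μ := μ)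
  have hne : ∑' i, μ (f i) ≠ ∞ := h ▸ measure_ne_top _ _
  simp only [Measure.real, h]
  rw [ENNReal.tsum_toReal_eq fun i => measure_ne_top _ _]
  exact ENNReal.hasSum_toReal hne

theorem Represents.sum {ρ : H → Measure S} [∀ ξ, IsFiniteMeasure (ρ ξ)] {f : ℕ → Set S}
    (hf : ∀ i, MeasurableSet (f i)) (hd : Pairwise fun i j => Disjoint (f i) (f j))
    {T : ℕ → H →L[ℂ] H} (hT : ∀ i, Represents ρ (f i) (T i)) (t : Finset ℕ) :
    Represents ρ (⋃ i ∈ t, f i) (∑ i ∈ t, T i) := by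
  intro ξ
  rw [measureReal_biUnion_finset (fun i _ j _ hij => hd hij) (fun i _ => hf i), sum_apply,
    inner_sum]
  push_cast
  exact Finset.sum_congr rfl fun i _ => hT i ξ

theorem Represents.re_inner_le {ρ : H → Measure S} [∀ ξ, IsFiniteMeasure (ρ ξ)]
    (huniv : ∀ ξ, (ρ ξ).real univ = ‖ξ‖ ^ 2) {s : Set S} {T : H →L[ℂ] H}
    (h : Represents ρ s T) (ξ : H) : (inner ℂ ξ (T ξ) : ℂ).re ≤ ‖ξ‖ ^ 2 := by
  rw [h ξ, Complex.ofReal_re, ← huniv]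
  exact measureReal_mono (subset_univ s)

variable [CompleteSpace H]

/-- Finite sums of the `T i` are positive contractions, so the squared norm of `∑ i ∈ t, T i ξ` is
at most the `ρ ξ`-measure of the corresponding union. The series therefore converges strongly. -/
theorem exists_represents_iUnion {ρ : H → Measure S} [∀ ξ, IsFiniteMeasure (ρ ξ)]
    (huniv : ∀ ξ, (ρ ξ).real univ = ‖ξ‖ ^ 2) {f : ℕ → Set S}
    (hf : ∀ i, MeasurableSet (f i)) (hd : Pairwise fun i j => Disjoint (f i) (f j))
    {T : ℕ → H →L[ℂ] H} (hT : ∀ i, Represents ρ (f i) (T i)) :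
    ∃ R, Represents ρ (⋃ i, f i) R := by
  have hsum : ∀ ξ, Summable fun i => T i ξ := by
    intro ξ
    refine summable_iff_vanishing_norm.2 fun ε hε => ?_
    obtain ⟨s, hs⟩ := summable_iff_vanishing_norm.1
      (hasSum_measureReal_iUnion (ρ ξ) hf hd).summable (ε ^ 2) (by positivity)
    refine ⟨s, fun t ht => ?_⟩
    have hrep := Represents.sum hf hd hT t
    have h1 := norm_sq_apply_le hrep.isPositive
      (le_one_of_inner_self_le hrep.isPositive (hrep.re_inner_le huniv)) ξ
    rw [hrep ξ, Complex.ofReal_re, sum_apply,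
      measureReal_biUnion_finset (fun i _ j _ hij => hd hij) (fun i _ => hf i)] at h1
    exact lt_of_pow_lt_pow_left₀ 2 hε.le (h1.trans_lt ((le_abs_self _).trans_lt (hs t ht)))
  have hlim : Tendsto (fun (t : Finset ℕ) ξ => (∑ i ∈ t, T i) ξ) atTop
      (𝓝 fun ξ => ∑' i, T i ξ) := by
    refine tendsto_pi_nhds.2 fun ξ => ?_
    simp only [sum_apply]
    exact (hsum ξ).hasSum
  -- Boundedness of the pointwise limit is Banach–Steinhaus.
  refine ⟨continuousLinearMapOfTendsto (fun t : Finset ℕ => ∑ i ∈ t, T i) hlim, fun ξ => ?_⟩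
  change (inner ℂ ξ (∑' i, T i ξ) : ℂ) = _
  have h1 : HasSum (fun i => (inner ℂ ξ (T i ξ) : ℂ)) (inner ℂ ξ (∑' i, T i ξ)) :=
    (hsum ξ).hasSum.mapL (innerSL ℂ ξ)
  refine h1.unique ?_
  simp only [hT _ ξ]
  exact Complex.hasSum_ofReal.2 (hasSum_measureReal_iUnion (ρ ξ) hf hd)

theorem exists_represents {ρ : H → Measure S} [∀ ξ, IsFiniteMeasure (ρ ξ)]
    (huniv : ∀ ξ, (ρ ξ).real univ = ‖ξ‖ ^ 2) {C : Set (Set S)}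
    (hgen : ‹MeasurableSpace S› = MeasurableSpace.generateFrom C) (hpi : IsPiSystem C)
    (hC : ∀ s ∈ C, ∃ T, Represents ρ s T) {s : Set S} (hs : MeasurableSet s) :
    ∃ T, Represents ρ s T := by
  induction s, hs using MeasurableSpace.induction_on_inter hgen hpi with
  | empty => exact ⟨0, fun ξ => by simp⟩
  | basic s hs => exact hC s hs
  | compl s hs ih =>
    obtain ⟨T, hT⟩ := ih
    refine ⟨1 - T, fun ξ => ?_⟩
    rw [measureReal_compl hs, huniv, sub_apply, inner_sub_right, hT ξ]
    simp [inner_self_eq_norm_sq_to_K]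
  | iUnion f hd hf ih =>
    choose T hT using ih
    exact exists_represents_iUnion huniv hf hd hT

/-- A family of measures, each of whose values is a quadratic form, comes from a quantum
probability measure. -/
theorem exists_qpm_of_represents {ρ : H → Measure S} [∀ ξ, IsFiniteMeasure (ρ ξ)]
    (huniv : ∀ ξ, (ρ ξ).real univ = ‖ξ‖ ^ 2)
    (h : ∀ s, MeasurableSet s → ∃ T, Represents ρ s T) :
    ∃ G : QPM S H, ∀ s, MeasurableSet s → Represents ρ s (G.toFun s) := by
  classical
  choose! T hT using h
  have hT' : ∀ s, MeasurableSet s → Represents ρ s (if MeasurableSet s then T s else 0) := by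
    intro s hs
    rw [if_pos hs]
    exact hT s hs
  refine ⟨⟨fun s => if MeasurableSet s then T s else 0, fun s hs => if_neg hs,
    fun s hs => (hT' s hs).isPositive, ?_, ?_⟩, hT'⟩
  · refine ext_of_inner_self fun ξ => ?_
    rw [hT' _ .univ, huniv]
    simp [inner_self_eq_norm_sq_to_K]
  · intro f hf hd
    refine hasSumWeakStar_iff.2 fun ξ η => ?_
    have hrep := Represents.sum hf hd (fun i => hT' _ (hf i))
    -- The partial sums represent finite unions, so they have norm at most 1, and weak operator
    -- convergence upgrades to weak* convergence.
    refine tendsto_normalFunctional (C := 1) (fun t => norm_le_one_of_isPositive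
      (hrep t).isPositive ((hrep t).re_inner_le huniv))
      (fun η ξ => tendsto_inner_of_tendsto_inner_self (fun ξ => ?_) η ξ) ξ η
    rw [hT' _ (.iUnion hf) ξ]
    simp only [sum_apply, inner_sum, hT' _ (hf _) ξ]
    exact Complex.hasSum_ofReal.2 (hasSum_measureReal_iUnion (ρ ξ) hf hd)

end Representation

/-! ### Quantum probability measures and their products -/

namespace QPM

variable {H : Type*} [NormedAddCommGroup H] [InnerProductSpace ℂ H]
  {S : Type*} [MeasurableSpace S]

theorem isPositive (E : QPM S H) (s : Set S) : (E.toFun s).IsPositive := by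
  by_cases hs : MeasurableSet s
  · exact E.isPositive' s hs
  · rw [E.not_measurable' s hs]
    exact ContinuousLinearMap.isPositive_zero

theorem hasSum_inner (E : QPM S H) {f : ℕ → Set S} (hf : ∀ i, MeasurableSet (f i))
    (hd : Pairwise fun i j => Disjoint (f i) (f j)) (η ξ : H) :
    HasSum (fun i => (inner ℂ η (E.toFun (f i) ξ) : ℂ)) (inner ℂ η (E.toFun (⋃ i, f i) ξ)) :=
  (E.iUnion' f hf hd).hasSum_inner η ξ

theorem toFun_empty (E : QPM S H) : E.toFun ∅ = 0 := by
  refine ext_of_inner_self fun ξ => ?_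
  -- Additivity for the constant sequence `∅`: a constant series is summable only if its term is 0.
  have h := E.hasSum_inner (f := fun _ => ∅) (fun _ => .empty) (fun _ _ _ => disjoint_bot_left) ξ ξ
  simpa using (summable_const_iff _).1 h.summable

variable [CompleteSpace H]

/-- The measure `α ↦ ⟨ξ, E(α) R ξ⟩` for a positive operator `R` that commutes with `E`. -/
theorem exists_measure_mul (E : QPM S H) {R : H →L[ℂ] H} (hR : R.IsPositive)
    (hc : ∀ s, MeasurableSet s → Commute (E.toFun s) R) (ξ : H) :
    ∃ μ : Measure S, IsFiniteMeasure μ ∧ ∀ s, MeasurableSet s →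
      (inner ℂ ξ ((E.toFun s * R) ξ) : ℂ) = μ.real s := by
  have hpos : ∀ s, MeasurableSet s → (E.toFun s * R).IsPositive := fun s hs =>
    (ContinuousLinearMap.nonneg_iff_isPositive _).1 ((hc s hs).mul_nonneg
      ((ContinuousLinearMap.nonneg_iff_isPositive _).2 (E.isPositive s))
      ((ContinuousLinearMap.nonneg_iff_isPositive _).2 hR))
  have hnn : ∀ s, MeasurableSet s → 0 ≤ (inner ℂ ξ ((E.toFun s * R) ξ) : ℂ).re :=
    fun s hs => (hpos s hs).re_inner_nonneg_right ξ
  let μ : Measure S := Measure.ofMeasurable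
    (fun s _ => ENNReal.ofReal (inner ℂ ξ ((E.toFun s * R) ξ) : ℂ).re)
    (by simp [E.toFun_empty])
    (fun f hf hd => by
      have h := Complex.hasSum_re (E.hasSum_inner hf hd ξ (R ξ))
      exact (congrArg ENNReal.ofReal h.tsum_eq.symm).trans
        (ENNReal.ofReal_tsum_of_nonneg (fun i => hnn _ (hf i)) h.summable))
  have hμ : ∀ s, MeasurableSet s → μ s = ENNReal.ofReal (inner ℂ ξ ((E.toFun s * R) ξ) : ℂ).re :=
    fun s hs => Measure.ofMeasurable_apply s hs
  refine ⟨μ, ⟨by rw [hμ _ .univ]; exact ENNReal.ofReal_lt_top⟩, fun s hs => ?_⟩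
  rw [Measure.real, hμ s hs, ENNReal.toReal_ofReal (hnn s hs)]
  exact inner_self_eq_re (hpos s hs) ξ

theorem exists_measure (E : QPM S H) (ξ : H) :
    ∃ μ : Measure S, IsFiniteMeasure μ ∧ ∀ s, MeasurableSet s →
      (inner ℂ ξ (E.toFun s ξ) : ℂ) = μ.real s := by
  simpa using E.exists_measure_mul ContinuousLinearMap.isPositive_one
    (fun s _ => Commute.one_right _) ξ

theorem toFun_compl (E : QPM S H) {s : Set S} (hs : MeasurableSet s) :
    E.toFun sᶜ = 1 - E.toFun s := by
  refine ext_of_inner_self fun ξ => ?_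
  obtain ⟨μ, _, hμ⟩ := E.exists_measure ξ
  rw [sub_apply, inner_sub_right, ← E.univ', hμ _ .univ, hμ _ hs, hμ _ hs.compl,
    measureReal_compl hs, Complex.ofReal_sub]

theorem re_inner_mono (E : QPM S H) {s t : Set S} (hs : MeasurableSet s) (ht : MeasurableSet t)
    (hst : s ⊆ t) (ξ : H) :
    (inner ℂ ξ (E.toFun s ξ) : ℂ).re ≤ (inner ℂ ξ (E.toFun t ξ) : ℂ).re := by
  obtain ⟨μ, _, hμ⟩ := E.exists_measure ξ
  rw [hμ s hs, hμ t ht, Complex.ofReal_re, Complex.ofReal_re]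
  exact measureReal_mono hst

theorem re_inner_le (E : QPM S H) {s : Set S} (hs : MeasurableSet s) (ξ : H) :
    (inner ℂ ξ (E.toFun s ξ) : ℂ).re ≤ ‖ξ‖ ^ 2 := by
  refine (E.re_inner_mono hs .univ (subset_univ s) ξ).trans_eq ?_
  rw [E.univ', one_apply_eq_self, inner_self_eq_norm_sq_to_K]
  norm_cast

theorem ext_of_generateFrom {E F : QPM S H} {C : Set (Set S)}
    (hgen : ‹MeasurableSpace S› = MeasurableSpace.generateFrom C) (hpi : IsPiSystem C)
    (h : ∀ s ∈ C, E.toFun s = F.toFun s) : E = F := by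
  have hC : ∀ s, MeasurableSet s → E.toFun s = F.toFun s := by
    intro s hs
    induction s, hs using MeasurableSpace.induction_on_inter hgen hpi with
    | empty => rw [E.toFun_empty, F.toFun_empty]
    | basic s hs => exact h s hs
    | compl s hs ih => rw [E.toFun_compl hs, F.toFun_compl hs, ih]
    | iUnion f hd hf ih =>
      refine ext_of_inner_self fun ξ => (E.hasSum_inner hf hd ξ ξ).unique ?_
      simpa only [ih] using F.hasSum_inner hf hd ξ ξ
  refine QPM.ext (funext fun s => ?_)
  by_cases hs : MeasurableSet s
  · exact hC s hs
  · rw [E.not_measurable' s hs, F.not_measurable' s hs]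

/-- For a disjoint union with value `Q`, each projection `P i` of the sequence is below `Q`, so `Q *
P i = P i`; summing over `i` gives `Q * Q = Q`. -/
theorem isSpectral_of_generateFrom {E : QPM S H} {C : Set (Set S)}
    (hgen : ‹MeasurableSpace S› = MeasurableSpace.generateFrom C) (hpi : IsPiSystem C)
    (h : ∀ s ∈ C, IsStarProjection (E.toFun s)) : E.IsSpectral := by
  intro s hs
  induction s, hs using MeasurableSpace.induction_on_inter hgen hpi with
  | empty => rw [E.toFun_empty]; exact .zero _
  | basic s hs => exact h s hs
  | compl s hs ih => rw [E.toFun_compl hs]; exact ih.one_sub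
  | iUnion f hd hf ih =>
    have hT := E.isPositive (⋃ i, f i)
    have habs : ∀ i, E.toFun (⋃ i, f i) * E.toFun (f i) = E.toFun (f i) := fun i =>
      mul_eq_right_of_isStarProjection (ih i) hT
        (E.re_inner_mono (hf i) (.iUnion hf) (subset_iUnion f i)) (E.re_inner_le (.iUnion hf))
    refine ⟨ext_of_inner_self fun ξ => ?_, hT.isSelfAdjoint⟩
    have h1 := E.hasSum_inner hf hd (E.toFun (⋃ i, f i) ξ) ξ
    have h2 : ∀ i, (inner ℂ (E.toFun (⋃ i, f i) ξ) (E.toFun (f i) ξ) : ℂ) =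
        inner ℂ ξ (E.toFun (f i) ξ) := by
      intro i
      conv_rhs => rw [← habs i]
      exact hT.inner_left_eq_inner_right _ _
    simp only [h2] at h1
    exact (hT.inner_left_eq_inner_right _ _).symm.trans (h1.unique (E.hasSum_inner hf hd ξ ξ))

variable {A : Type*} [MeasurableSpace A] {B : Type*} [MeasurableSpace B]

/-- Commuting quantum probability measures have a product. -/
theorem exists_prod [StandardBorelSpace B] (E : QPM A H) (F : QPM B H)
    (hc : ∀ δ θ, MeasurableSet δ → MeasurableSet θ → Commute (E.toFun δ) (F.toFun θ)) :
    ∃ G : QPM (A × B) H, ∀ δ θ, MeasurableSet δ → MeasurableSet θ →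
      G.toFun (δ ×ˢ θ) = E.toFun δ * F.toFun θ := by
  -- The value 0 off the measurable sets extends commutation to all sets, as needed to define both
  -- families of partial measures on every set.
  have hc' : ∀ δ θ, Commute (E.toFun δ) (F.toFun θ) := by
    intro δ θ
    by_cases hδ : MeasurableSet δ
    · by_cases hθ : MeasurableSet θ
      · exact hc δ θ hδ hθ
      · rw [F.not_measurable' θ hθ]; exact .zero_right _
    · rw [E.not_measurable' δ hδ]; exact .zero_left _
  have hρ : ∀ ξ : H, ∃ ρ : Measure (A × B), IsFiniteMeasure ρ ∧ ∀ δ θ, MeasurableSet δ →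
      MeasurableSet θ → (inner ℂ ξ ((E.toFun δ * F.toFun θ) ξ) : ℂ) = ρ.real (δ ×ˢ θ) := by
    intro ξ
    choose m hm hmE using fun θ => E.exists_measure_mul (F.isPositive θ) (fun δ _ => hc' δ θ) ξ
    choose n hn hnF using fun δ =>
      F.exists_measure_mul (E.isPositive δ) (fun θ _ => (hc' δ θ).symm) ξ
    have hb : IsBimeasure m n := ⟨hm, hn, fun θ δ hθ hδ => by
      rw [← ENNReal.toReal_eq_toReal_iff' (measure_ne_top _ _) (measure_ne_top _ _)]
      have h := hmE θ δ hδ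
      rw [(hc' δ θ).eq, hnF δ θ hθ] at h
      exact_mod_cast h.symm⟩
    obtain ⟨ρ, hρ⟩ := hb.exists_measure_prod
    refine ⟨ρ, ⟨?_⟩, fun δ θ hδ hθ => ?_⟩
    · rw [← univ_prod_univ, hρ _ _ .univ .univ]
      exact measure_lt_top _ _
    · rw [hmE θ δ hδ, Measure.real, Measure.real, hρ θ δ hθ hδ]
  choose ρ hfin hρ using hρ
  have huniv : ∀ ξ, (ρ ξ).real univ = ‖ξ‖ ^ 2 := by
    intro ξ
    have h := hρ ξ univ univ .univ .univ
    rw [E.univ', F.univ', univ_prod_univ, one_mul, one_apply_eq_self,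
      inner_self_eq_norm_sq_to_K] at h
    exact (Complex.ofReal_injective (by rw [← h]; norm_cast)).symm
  obtain ⟨G, hG⟩ := exists_qpm_of_represents huniv fun s hs =>
    exists_represents huniv generateFrom_prod.symm isPiSystem_prod (by
      rintro _ ⟨δ, hδ, θ, hθ, rfl⟩
      exact ⟨E.toFun δ * F.toFun θ, fun ξ => hρ ξ δ θ hδ hθ⟩) hs
  refine ⟨G, fun δ θ hδ hθ => ext_of_inner_self fun ξ => ?_⟩
  rw [hG _ (hδ.prod hθ) ξ, hρ ξ δ θ hδ hθ]

end QPM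

/-! ### Weak measurability -/

section WeakMeasurability

/-- Distinct members lie at distance `√2 > 1`, so the balls of radius 1/2 around them are disjoint.
-/
theorem countable_of_orthonormal {H : Type*} [NormedAddCommGroup H] [InnerProductSpace ℂ H]
    [SeparableSpace H] {ι : Type*} {e : ι → H} (he : Orthonormal ℂ e) : Countable ι := by
  refine Pairwise.countable_of_isOpen_disjoint (s := fun i => Metric.ball (e i) (1 / 2))
    (fun i j hij => Metric.ball_disjoint_ball ?_) (fun i => Metric.isOpen_ball)
    (fun i => Metric.nonempty_ball.2 (by norm_num))
  have h := norm_sub_sq (𝕜 := ℂ) (e i) (e j)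
  rw [he.inner_eq_zero hij, he.norm_eq_one, he.norm_eq_one] at h
  rw [dist_eq_norm]
  simp only [map_zero] at h
  nlinarith [norm_nonneg (e i - e j)]

variable {H : Type*} [NormedAddCommGroup H] [InnerProductSpace ℂ H] [CompleteSpace H]
  {X : Type*} [MeasurableSpace X] {S : Type*} [MeasurableSpace S]

theorem weaklyMeasurable_of_generateFrom (G : X → QPM S H) {C : Set (Set S)}
    (hgen : ‹MeasurableSpace S› = MeasurableSpace.generateFrom C) (hpi : IsPiSystem C)
    (h : ∀ s ∈ C, WeaklyMeasurable fun x => (G x).toFun s) {s : Set S} (hs : MeasurableSet s) :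
    WeaklyMeasurable fun x => (G x).toFun s := by
  induction s, hs using MeasurableSpace.induction_on_inter hgen hpi with
  | empty => intro ξ η; simp [QPM.toFun_empty]
  | basic s hs => exact h s hs
  | compl s hs ih =>
    intro ξ η
    simp only [QPM.toFun_compl _ hs, sub_apply, inner_sub_right]
    exact measurable_const.sub (ih ξ η)
  | iUnion f hd hf ih =>
    intro ξ η
    refine measurable_of_tendsto_metrizable' (atTop : Filter (Finset ℕ))
      (fun t => Finset.measurable_sum t fun i _ => ih i ξ η) ?_
    refine tendsto_pi_nhds.2 fun x => ?_
    simpa only [HasSum, SummationFilter.unconditional_filter, Finset.sum_apply] using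
      (G x).hasSum_inner hf hd η ξ

/-- By Parseval, the inner product is a countable sum of products of measurable coordinates. -/
theorem measurable_inner_of_measurable_inner [SeparableSpace H] {u v : X → H}
    (hu : ∀ η : H, Measurable fun x => (inner ℂ η (u x) : ℂ))
    (hv : ∀ η : H, Measurable fun x => (inner ℂ η (v x) : ℂ)) :
    Measurable fun x => (inner ℂ (u x) (v x) : ℂ) := by
  obtain ⟨w, b, -⟩ := exists_hilbertBasis ℂ H
  have : Countable w := countable_of_orthonormal b.orthonormal
  refine measurable_of_tendsto_metrizable' (atTop : Filter (Finset w))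
    (f := fun t x => ∑ i ∈ t, (inner ℂ (u x) (b i) : ℂ) * inner ℂ (b i) (v x))
    (fun t => Finset.measurable_sum t fun i _ => ?_)
    (tendsto_pi_nhds.2 fun x => b.hasSum_inner_mul_inner (u x) (v x))
  have h := Complex.continuous_conj.measurable.comp (hu (b i))
  simp only [Function.comp_def, inner_conj_symm] at h
  exact h.mul (hv (b i))

end WeakMeasurability

end QInfo

/-! ### The product channel -/

theorem theorem3p5
    {X : Type*} [TopologicalSpace X] [CompactSpace X] [T2Space X] [SecondCountableTopology X]
    [MeasurableSpace X] [BorelSpace X]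
    {Y : Type*} [TopologicalSpace Y] [CompactSpace Y] [T2Space Y] [SecondCountableTopology Y]
    [MeasurableSpace Y] [BorelSpace Y]
    {A : Type*} [TopologicalSpace A] [CompactSpace A] [T2Space A] [SecondCountableTopology A]
    [MeasurableSpace A] [BorelSpace A]
    {B : Type*} [TopologicalSpace B] [CompactSpace B] [T2Space B] [SecondCountableTopology B]
    [MeasurableSpace B] [BorelSpace B]
    {H : Type*} [NormedAddCommGroup H] [InnerProductSpace ℂ H] [CompleteSpace H]
    [SeparableSpace H]
    (E : QInfo.Channel X A H) (F : QInfo.Channel Y B H) (hEF : QInfo.CommutingRanges E F) :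
    (∃! G : QInfo.Channel (X × Y) (A × B) H, QInfo.IsProductChannel E F G) ∧
      (E.IsProjectionValued → F.IsProjectionValued →
        ∀ G : QInfo.Channel (X × Y) (A × B) H, QInfo.IsProductChannel E F G →
          G.IsProjectionValued) := by
  -- A second countable compact Hausdorff space is metrizable, and compact metric spaces are
  -- complete.
  have : PolishSpace B := by
    let := metrizableSpaceMetric B
    infer_instance
  choose G hG using fun p : X × Y =>
    (E.qpm p.1).exists_prod (F.qpm p.2) (fun δ θ hδ hθ => hEF p.1 p.2 δ θ hδ hθ)
  refine ⟨⟨⟨G, fun s hs => QInfo.weaklyMeasurable_of_generateFrom G generateFrom_prod.symm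
    isPiSystem_prod ?_ hs⟩, fun δ θ hδ hθ x y => hG (x, y) δ θ hδ hθ, fun G' hG' => ?_⟩, ?_⟩
  · rintro _ ⟨δ, hδ, θ, hθ, rfl⟩ ξ η
    -- Moving the self-adjoint `E(δ | x)` to the other side leaves two vector functions, each weakly
    -- measurable.
    have h : ∀ p : X × Y, (inner ℂ η ((G p).toFun (δ ×ˢ θ) ξ) : ℂ) =
        inner ℂ ((E.qpm p.1).toFun δ η) ((F.qpm p.2).toFun θ ξ) := fun p => by
      rw [hG p δ θ hδ hθ]
      exact (((E.qpm p.1).isPositive δ).inner_left_eq_inner_right _ _).symm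
    simp only [h]
    exact QInfo.measurable_inner_of_measurable_inner
      (fun ζ => (E.weaklyMeasurable' δ hδ η ζ).comp measurable_fst)
      (fun ζ => (F.weaklyMeasurable' θ hθ ξ ζ).comp measurable_snd)
  · refine QInfo.Channel.ext (funext fun p =>
      QInfo.QPM.ext_of_generateFrom generateFrom_prod.symm isPiSystem_prod ?_)
    rintro _ ⟨δ, hδ, θ, hθ, rfl⟩
    exact (hG' δ θ hδ hθ p.1 p.2).trans (hG p δ θ hδ hθ).symm
  · intro hE hF G' hG' p
    refine QInfo.QPM.isSpectral_of_generateFrom generateFrom_prod.symm isPiSystem_prod ?_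
    rintro _ ⟨δ, hδ, θ, hθ, rfl⟩
    have h : (G'.qpm p).toFun (δ ×ˢ θ) = _ := hG' δ θ hδ hθ p.1 p.2
    rw [h]
    exact (hE p.1 δ hδ).mul (hF p.2 θ hθ) (hEF p.1 p.2 δ θ hδ hθ)
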